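/- **Setting.** Let $\alpha_{\mathrm{sys}}>0$. For $\alpha>0$ let $V^{\alpha}(x,x)=1+\alpha$, $V^{\alpha}(y,y)=1$, $V^\alpha(x,y)=V^\alpha(y,x)=0$. On a connected graph $G$ with node set $\{1,\dots,N\}$ put $U_i^\alpha(a)=\sum_{j\sim i}V^\alpha(a_i,a_j)$ for $a\in\{x,y\}^N$ and $W(a)=\sum_i U_i^{\alpha_{\mathrm{sys}}}(a)$. For action sets $\mathcal A=\prod_i\mathcal A_i$ with $\emptyset\ne\mathcal A_i\subseteq\{x,y\}$ and utilities $U_i$, log-linear learning with parameter $\beta>0$ is the Markov chain on $\mathcal A$ in which a uniformly random agent $i$ switches to $z\in\mathcal A_i$ with probability proportional to $e^{\beta U_i(z,a_{-i})}$; $\mathrm{LLL}(\mathcal A,U;G)$ is the set of $a\in\mathcal A$ with $\lim_{\beta\to\infty}\pi_\beta(a)>0$, where $\pi_\beta$ is the stationary distribution. * *Broad attack*: a partition $S=(S_x,S_y)$ of the node set; $\tilde U_i^\alpha(a)=U_i^\alpha(a)+\mathbb 1(a_i=y)$ for $i\in S_y$ and $\tilde U^\alpha_i(a)=U_i^\alpha(a)+(1+\alpha)\mathbb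 1(a_i=x)$ for $i\in S_x$; the broad risk is $R_{\mathrm b}(\alpha,S;G)=1-\dfrac{\min_{a\in \mathrm{LLL}(\{x,y\}^N,\tilde U^\alpha;G)}W(a)}{\max_{a\in\{x,y\}^N}W(a)}$. * *Focused attack*: $F=(F_x,F_y)$ with $F_x\cap F_y=\emptyset$ and $F_x\cup F_y$ a nonempty strict subset of the node set; $\mathcal A(F)$ is the set of profiles with $a_i=x$ on $F_x$ and $a_i=y$ on $F_y$; the focused risk is $R_{\mathrm f}(\alpha,F;G)=1-\dfrac{\min_{a\in \mathrm{LLL}(\mathcal A(F),U^\alpha;G)}W(a)}{\max_{a\in\mathcal A(F)}W(a)}$. $R_{\mathrm b}^*(\alpha)$ and $R_{\mathrm f}^*(\alpha)$ are the suprema of $R_{\mathrm b}(\alpha,S;G)$, respectively $R_{\mathrm f}(\alpha,F;G)$, over all $N\ge3$, all connected graphs $G$ on $N$ nodes and all $S$, respectively $F$. For gains $\boldsymbol\alpha=(\alpha_1,\dots,\alpha_M)$, $M\ge 1$, and $\boldsymbol p\in\Delta_M=\{\boldsymbol p\in\mathbb R^M_{\ge 0}:\sum_j p_j=1\}$, let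 $\mathbb E^*_{\boldsymbol\alpha,\boldsymbol p}[R_{\mathrm b}]$ and $\mathbb E^*_{\boldsymbol\alpha,\boldsymbol p}[R_{\mathrm f}]$ be the suprema, over the same sets, of $\sum_jp_jR_{\mathrm b}(\alpha_j,S;G)$ and $\sum_jp_jR_{\mathrm f}(\alpha_j,F;G)$. **Statement.** Let $\alpha_{\mathrm{sys}}\le\alpha_1<\alpha_2<\cdots<\alpha_M$. For $\gamma_{\mathrm b}\in[R_{\mathrm b}^*(\alpha_M),1]$ the linear program $$\begin{aligned}v_{\mathrm f}(\gamma_{\mathrm b},\boldsymbol\alpha)=\min_{\boldsymbol p,\,v}\ v\quad\text{s.t. }&\sum_{i=1}^Mp_i=1,\quad p_i\ge0\ (1\le i\le M),\quad v\in[0,1],\\&\begin{bmatrix}A_{\mathrm f}&-\mathbb 1_M\\A_{\mathrm b}&0_M\end{bmatrix}\begin{bmatrix}\boldsymbol p\\v\end{bmatrix}\preceq\begin{bmatrix}0_M\\\gamma_{\mathrm b}\mathbb 1_M\end{bmatrix},\end{aligned}$$ where $\preceq$ is the elementwise order, $(A_{\mathrm b})_{kj}=R_{\mathrm b}^*(\alpha_k)$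 for $j\le k$ and $0$ otherwise, and $(A_{\mathrm f})_{kj}=R_{\mathrm f}^*(\alpha_k)$ for $j\ge k$ and $0$ otherwise, is feasible and attains its minimum; and for every $\boldsymbol p\in\Delta_M$ with $\mathbb E^*_{\boldsymbol\alpha,\boldsymbol p}[R_{\mathrm b}]\le\gamma_{\mathrm b}$, $$\mathbb E^*_{\boldsymbol\alpha,\boldsymbol p}[R_{\mathrm f}]\ \ge\ v_{\mathrm f}(\gamma_{\mathrm b},\boldsymbol\alpha).$$ Furthermore, $v_{\mathrm f}(\gamma_{\mathrm b},\boldsymbol\alpha)$ is (weakly) decreasing in $\gamma_{\mathrm b}\in[R_{\mathrm b}^*(\alpha_M),1]$. -/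

import Mathlib

open Filter Topology

noncomputable section

namespace CoordinationGame

/-- The two conventions. -/
inductive Choice
  | x
  | y
  deriving DecidableEq

instance : Fintype Choice :=
  ⟨{Choice.x, Choice.y}, fun c => by cases c <;> simp⟩

/-- An action profile of the agents `1, …, N`. -/
abbrev Profile (N : ℕ) := Fin N → Choice

/-! ### Graphical coordination games -/

/-- The payoff matrix with gain `α`: `1 + α` for coordinating on `x`, `1` for coordinating on `y`,
`0` for mis-coordination. -/
def payoff (α : ℝ) : Choice → Choice → ℝ
  | .x, .x => 1 + α
  | .y, .y => 1
  | _, _ => 0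

open Classical in
/-- `U_i^α(a)`: the sum of the payoffs (with gain `α`) of agent `i` against each neighbour. -/
def utility {N : ℕ} (G : SimpleGraph (Fin N)) (α : ℝ) (i : Fin N) (a : Profile N) : ℝ :=
  ∑ j ∈ Finset.univ.filter (fun j => G.Adj i j), payoff α (a i) (a j)

/-- The welfare `W(a)`: the sum of all the agents' benefits, with the true gain `αsys`. -/
def welfare {N : ℕ} (αsys : ℝ) (G : SimpleGraph (Fin N)) (a : Profile N) : ℝ :=
  ∑ i, utility G αsys i a

/-! ### Log-linear learning -/

/-- One-step transition probability from `a` to `a'` of log-linear learning with action sets `A`,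
utilities `U` and rationality `β`: an agent `i` is drawn uniformly, and it switches to `z ∈ A i`
with probability proportional to `exp (β U_i(z, a_{-i}))`. -/
def transition {N : ℕ} (A : Fin N → Finset Choice) (U : Fin N → Profile N → ℝ) (β : ℝ)
    (a a' : Profile N) : ℝ :=
  ∑ i, (1 / (N : ℝ)) * ∑ z ∈ A i,
    if a' = Function.update a i z then
      Real.exp (β * U i (Function.update a i z)) /
        ∑ z' ∈ A i, Real.exp (β * U i (Function.update a i z'))
    else 0

/-- `π` is a stationary distribution of log-linear learning on the profile space `∏ i, A i`. -/
structure IsStationary {N : ℕ} (A : Fin N → Finset Choice) (U : Fin N → Profile N → ℝ) (β : ℝ)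
    (π : Profile N → ℝ) : Prop where
  nonneg : ∀ a ∈ Fintype.piFinset A, 0 ≤ π a
  sum_eq_one : ∑ a ∈ Fintype.piFinset A, π a = 1
  balance : ∀ a' ∈ Fintype.piFinset A,
    ∑ a ∈ Fintype.piFinset A, π a * transition A U β a a' = π a'

/-- The stochastically stable states: the profiles `a ∈ ∏ i, A i` with `lim_{β → ∞} π_β(a) > 0`,
where `π_β` is the stationary distribution at rationality `β > 0`. -/
def LLL {N : ℕ} (A : Fin N → Finset Choice) (U : Fin N → Profile N → ℝ) : Set (Profile N) :=
  {a | a ∈ Fintype.piFinset A ∧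
    ∃ π : ℝ → Profile N → ℝ, (∀ β, 0 < β → IsStationary A U β (π β)) ∧
      ∃ l : ℝ, 0 < l ∧ Tendsto (fun β => π β a) atTop (𝓝 l)}

/-- The efficiency of the welfare-minimizing stochastically stable state, relative to the maximal
welfare over `∏ i, A i` (a minimum and a maximum over finite sets). -/
def efficiency {N : ℕ} (αsys : ℝ) (G : SimpleGraph (Fin N)) (A : Fin N → Finset Choice)
    (U : Fin N → Profile N → ℝ) : ℝ :=
  sInf (welfare αsys G '' LLL A U) /
    sSup (welfare αsys G '' (Fintype.piFinset A : Set (Profile N)))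

/-! ### Broad attacks -/

/-- A target set: every agent gets exactly one imposter, an `x`-imposter (agents in `Sx`) or a
`y`-imposter (agents in `Sy`). -/
structure TargetSet (N : ℕ) where
  Sx : Finset (Fin N)
  Sy : Finset (Fin N)
  disj : Disjoint Sx Sy
  cover : Sx ∪ Sy = Finset.univ

/-- The perceived utilities under a broad attack. -/
def perceivedUtility {N : ℕ} (G : SimpleGraph (Fin N)) (α : ℝ) (S : TargetSet N)
    (i : Fin N) (a : Profile N) : ℝ :=
  utility G α i a
    + (if i ∈ S.Sy then (if a i = Choice.y then 1 else 0) else 0)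
    + (if i ∈ S.Sx then (1 + α) * (if a i = Choice.x then 1 else 0) else 0)

/-- The broad risk `R_b(α, S; G)`. -/
def broadRisk {N : ℕ} (αsys : ℝ) (G : SimpleGraph (Fin N)) (S : TargetSet N) (α : ℝ) : ℝ :=
  1 - efficiency αsys G (fun _ => Finset.univ) (perceivedUtility G α S)

/-- The worst-case broad risk `R_b^*(α)`. -/
def worstBroadRisk (αsys α : ℝ) : ℝ :=
  sSup {r | ∃ N : ℕ, 3 ≤ N ∧ ∃ G : SimpleGraph (Fin N), G.Connected ∧
    ∃ S : TargetSet N, r = broadRisk αsys G S α}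

/-! ### Focused attacks -/

/-- A fixed set: a nonempty strict subset of agents, each forced to play `x` (agents in `Fx`) or
`y` (agents in `Fy`). -/
structure FixedSet (N : ℕ) where
  Fx : Finset (Fin N)
  Fy : Finset (Fin N)
  disj : Disjoint Fx Fy
  nonempty : (Fx ∪ Fy).Nonempty
  strict : Fx ∪ Fy ⊂ Finset.univ

/-- The action sets `A_i(F)`. -/
def FixedSet.actions {N : ℕ} (F : FixedSet N) (i : Fin N) : Finset Choice :=
  if i ∈ F.Fx then {Choice.x} else if i ∈ F.Fy then {Choice.y} else Finset.univ

/-- The focused risk `R_f(α, F; G)`. -/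
def focusedRisk {N : ℕ} (αsys : ℝ) (G : SimpleGraph (Fin N)) (F : FixedSet N) (α : ℝ) : ℝ :=
  1 - efficiency αsys G F.actions (utility G α)

/-- The worst-case focused risk `R_f^*(α)`. -/
def worstFocusedRisk (αsys α : ℝ) : ℝ :=
  sSup {r | ∃ N : ℕ, 3 ≤ N ∧ ∃ G : SimpleGraph (Fin N), G.Connected ∧
    ∃ F : FixedSet N, r = focusedRisk αsys G F α}

/-! ### Randomized gains -/

/-- The worst-case expected broad risk when gain `α j` is used with probability `p j`. -/
def worstExpectedBroadRisk {M : ℕ} (αsys : ℝ) (α p : Fin M → ℝ) : ℝ :=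
  sSup {r | ∃ N : ℕ, 3 ≤ N ∧ ∃ G : SimpleGraph (Fin N), G.Connected ∧
    ∃ S : TargetSet N, r = ∑ j, p j * broadRisk αsys G S (α j)}

/-- The worst-case expected focused risk when gain `α j` is used with probability `p j`. -/
def worstExpectedFocusedRisk {M : ℕ} (αsys : ℝ) (α p : Fin M → ℝ) : ℝ :=
  sSup {r | ∃ N : ℕ, 3 ≤ N ∧ ∃ G : SimpleGraph (Fin N), G.Connected ∧
    ∃ F : FixedSet N, r = ∑ j, p j * focusedRisk αsys G F (α j)}

/-! ### The linear program -/

/-- The lower triangular matrix whose `k`-th row has the entries `R_b^*(α k)` in columns `j ≤ k`. -/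
def broadMatrix {M : ℕ} (αsys : ℝ) (α : Fin M → ℝ) : Matrix (Fin M) (Fin M) ℝ :=
  Matrix.of fun k j => if j ≤ k then worstBroadRisk αsys (α k) else 0

/-- The upper triangular matrix whose `k`-th row has the entries `R_f^*(α k)` in columns `j ≥ k`. -/
def focusedMatrix {M : ℕ} (αsys : ℝ) (α : Fin M → ℝ) : Matrix (Fin M) (Fin M) ℝ :=
  Matrix.of fun k j => if k ≤ j then worstFocusedRisk αsys (α k) else 0

/-- The constraint matrix `[A_f, -1; A_b, 0]`. -/
def lpMatrix {M : ℕ} (αsys : ℝ) (α : Fin M → ℝ) :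
    Matrix (Fin M ⊕ Fin M) (Fin M ⊕ Unit) ℝ :=
  Matrix.fromBlocks (focusedMatrix αsys α) (Matrix.of fun _ _ => -1) (broadMatrix αsys α) 0

/-- Feasibility of `(p, v)` for the linear program with parameter `γ`. -/
structure LPFeasible {M : ℕ} (αsys γ : ℝ) (α : Fin M → ℝ) (p : Fin M → ℝ) (v : ℝ) : Prop where
  sum_eq_one : ∑ i, p i = 1
  nonneg : ∀ i, 0 ≤ p i
  mem_Icc : v ∈ Set.Icc (0 : ℝ) 1
  constraint : (lpMatrix αsys α).mulVec (Sum.elim p fun _ => v) ≤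
    Sum.elim (fun _ => (0 : ℝ)) (fun _ => γ)

/-- The set of the feasible objective values of the linear program. -/
def lpValues {M : ℕ} (αsys γ : ℝ) (α : Fin M → ℝ) : Set ℝ :=
  {v | ∃ p : Fin M → ℝ, LPFeasible αsys γ α p v}

/-- The value `v_f(γ, α)` of the linear program. -/
def lpValue {M : ℕ} (αsys γ : ℝ) (α : Fin M → ℝ) : ℝ :=
  sInf (lpValues αsys γ α)

end CoordinationGame

end

open CoordinationGame

/-! Write `E_b` and `E_f` for the worst-case expected risks of `p`. The bound holds because `(p,
E_f)` is itself feasible for the linear program whenever `E_b ≤ γ`. Its rows say that `R_b^*(α k)`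
times the mass of the gains up to `α k` is at most `γ`, and that `R_f^*(α k)` times the mass of the
gains from `α k` on is at most `v`. So it suffices that a risk attained at `α k` can be attained, by
one instance, at all smaller gains (broad) or all larger gains (focused); `iSup_mul_sum_le` then
gives the rows.

Both games have exact potentials, so the stochastically stable states are the potential maximizers
(`IsPotential.mem_LLL_iff`).

Focused: the potential is half the welfare, which is affine in the gain. Raising the gain moves the
maximizer to a larger slope, and so to a welfare no larger at `αsys`. The same instance therefore
serves all larger gains (`focusedRisk_mono`).

Broad: the risk of a fixed instance need not be monotone, so the instance is changed
(`exists_dominating_broad`). Take a worst stable state and a connected component `T` of its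
`y`-nodes with at least the average ratio of boundary to inner edges. Stability against turning `T`
to `x` bounds its edges by its number of imposters. With `e + 1` nodes and `c` boundary edges in
`T`, the star with `e` leaves playing `y` and `c` leaves playing `x` is no more efficient, and its
stability condition `α e + (1 + α) c ≤ e + 1` survives lowering `α`.

Attainment follows from compactness, and monotonicity from the growth of the feasible set with `γ`.
-/

namespace CoordinationGame

/-! ### Log-linear learning in potential games -/

section LogLinear

variable {N : ℕ} {A : Fin N → Finset Choice} {U : Fin N → Profile N → ℝ} {Φ : Profile N → ℝ}

/-- `Φ` is an exact potential for the utilities `U`. -/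
def IsPotential (U : Fin N → Profile N → ℝ) (Φ : Profile N → ℝ) : Prop :=
  ∀ i a z z', Φ (Function.update a i z) - Φ (Function.update a i z') =
    U i (Function.update a i z) - U i (Function.update a i z')

/-- The normalizing constant of the choice rule of agent `i`. -/
noncomputable def choiceWeight (A : Fin N → Finset Choice) (U : Fin N → Profile N → ℝ) (β : ℝ) (i : Fin N)
    (a : Profile N) : ℝ :=
  ∑ z ∈ A i, Real.exp (β * U i (Function.update a i z))

theorem update_mem_piFinset {a : Profile N} (ha : a ∈ Fintype.piFinset A) {i : Fin N} {z : Choice}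
    (hz : z ∈ A i) : Function.update a i z ∈ Fintype.piFinset A := by
  rw [Fintype.mem_piFinset] at ha ⊢
  intro j
  rcases eq_or_ne j i with rfl | h
  · simpa using hz
  · simpa [h] using ha j

theorem choiceWeight_pos {a : Profile N} (ha : a ∈ Fintype.piFinset A) (β : ℝ) (i : Fin N) :
    0 < choiceWeight A U β i a :=
  Finset.sum_pos (fun _ _ => Real.exp_pos _) ⟨a i, Fintype.mem_piFinset.1 ha i⟩

theorem choiceWeight_update (β : ℝ) (i : Fin N) (a : Profile N) (z : Choice) :
    choiceWeight A U β i (Function.update a i z) = choiceWeight A U β i a := by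
  simp [choiceWeight]

/-- The part of the transition probability contributed by agent `i`. -/
theorem sum_choice_eq (β : ℝ) (i : Fin N) {a a' : Profile N} (ha' : a' ∈ Fintype.piFinset A) :
    (∑ z ∈ A i, if a' = Function.update a i z then
      Real.exp (β * U i (Function.update a i z)) /
        ∑ z' ∈ A i, Real.exp (β * U i (Function.update a i z')) else 0) =
    if a' = Function.update a i (a' i) then
      Real.exp (β * U i a') / choiceWeight A U β i a else 0 := by
  rw [Finset.sum_eq_single_of_mem (a' i) (Fintype.mem_piFinset.1 ha' i)]
  · split_ifs with h
    · rw [← h, choiceWeight]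
    · rfl
  · intro z _ hz
    rw [if_neg]
    intro h
    apply hz
    rw [h]
    simp

theorem transition_eq (β : ℝ) {a a' : Profile N} (ha' : a' ∈ Fintype.piFinset A) :
    transition A U β a a' = ∑ i, (1 / (N : ℝ)) *
      if a' = Function.update a i (a' i) then
        Real.exp (β * U i a') / choiceWeight A U β i a else 0 := by
  unfold transition
  exact Finset.sum_congr rfl fun i _ => by rw [sum_choice_eq β i ha']

theorem transition_nonneg (β : ℝ) {a a' : Profile N} (ha : a ∈ Fintype.piFinset A)
    (ha' : a' ∈ Fintype.piFinset A) : 0 ≤ transition A U β a a' := by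
  rw [transition_eq β ha']
  refine Finset.sum_nonneg fun i _ => mul_nonneg (by positivity) ?_
  have := choiceWeight_pos (U := U) ha β i
  split_ifs <;> positivity

theorem transition_update_pos (β : ℝ) {a : Profile N} (ha : a ∈ Fintype.piFinset A) {i : Fin N}
    {z : Choice} (hz : z ∈ A i) : 0 < transition A U β a (Function.update a i z) := by
  have hN : (0 : ℝ) < N := by exact_mod_cast i.pos
  rw [transition_eq β (update_mem_piFinset ha hz)]
  refine Finset.sum_pos' (fun j _ => mul_nonneg (by positivity) ?_) ⟨i, Finset.mem_univ _, ?_⟩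
  · have := choiceWeight_pos (U := U) ha β j
    split_ifs <;> positivity
  · have := choiceWeight_pos (U := U) ha β i
    rw [if_pos (by simp)]
    positivity

theorem sum_transition (hN : 0 < N) (β : ℝ) {a : Profile N} (ha : a ∈ Fintype.piFinset A) :
    ∑ a' ∈ Fintype.piFinset A, transition A U β a a' = 1 := by
  unfold transition
  rw [Finset.sum_comm]
  have key : ∀ i, ∑ a' ∈ Fintype.piFinset A, (1 / (N : ℝ)) * (∑ z ∈ A i,
      if a' = Function.update a i z then
        Real.exp (β * U i (Function.update a i z)) /
          ∑ z' ∈ A i, Real.exp (β * U i (Function.update a i z')) else 0) = 1 / (N : ℝ) := by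
    intro i
    rw [← Finset.mul_sum, Finset.sum_comm]
    have : ∀ z ∈ A i, (∑ a' ∈ Fintype.piFinset A, if a' = Function.update a i z then
        Real.exp (β * U i (Function.update a i z)) /
          ∑ z' ∈ A i, Real.exp (β * U i (Function.update a i z')) else 0) =
        Real.exp (β * U i (Function.update a i z)) / choiceWeight A U β i a := by
      intro z hz
      rw [Finset.sum_ite_eq', if_pos (update_mem_piFinset ha hz), choiceWeight]
    rw [Finset.sum_congr rfl this, ← Finset.sum_div]
    change _ * (choiceWeight A U β i a / choiceWeight A U β i a) = _
    rw [div_self (choiceWeight_pos ha β i).ne', mul_one]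
  rw [Finset.sum_congr rfl fun i _ => key i]
  have : (N : ℝ) ≠ 0 := by positivity
  simp [this]

/-- Detailed balance, agent by agent: the normalizing constant of agent `i` ignores coordinate `i`,
so it is the same in both directions, and the potential identity matches the exponents. -/
theorem IsPotential.reversible (hΦ : IsPotential U Φ) (β : ℝ) {a a' : Profile N}
    (ha : a ∈ Fintype.piFinset A) (ha' : a' ∈ Fintype.piFinset A) :
    Real.exp (β * Φ a) * transition A U β a a' = Real.exp (β * Φ a') * transition A U β a' a := by
  rw [transition_eq β ha, transition_eq β ha', Finset.mul_sum, Finset.mul_sum]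
  refine Finset.sum_congr rfl fun i _ => ?_
  by_cases h : a' = Function.update a i (a' i)
  · have h' : a = Function.update a' i (a i) := by
      rw [h]; simp
    have hw : choiceWeight A U β i a' = choiceWeight A U β i a := by
      rw [h, choiceWeight_update]
    have hp := hΦ i a (a i) (a' i)
    rw [← h, Function.update_eq_self] at hp
    rw [if_pos h, if_pos h', hw]
    have : Real.exp (β * Φ a) * Real.exp (β * U i a') =
        Real.exp (β * Φ a') * Real.exp (β * U i a) := by
      rw [← Real.exp_add, ← Real.exp_add]
      congr 1
      linear_combination β * hp
    linear_combination (1 / (N : ℝ)) / choiceWeight A U β i a * this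
  · have h' : ¬ a = Function.update a' i (a i) := by
      intro h'
      apply h
      rw [h']; simp
    rw [if_neg h, if_neg h']
    simp

/-- The Gibbs distribution of the potential `Φ`. -/
noncomputable def gibbs (A : Fin N → Finset Choice) (Φ : Profile N → ℝ) (β : ℝ) (a : Profile N) : ℝ :=
  Real.exp (β * Φ a) / ∑ b ∈ Fintype.piFinset A, Real.exp (β * Φ b)

theorem partition_pos (hA : (Fintype.piFinset A).Nonempty) (β : ℝ) :
    0 < ∑ b ∈ Fintype.piFinset A, Real.exp (β * Φ b) :=
  Finset.sum_pos (fun _ _ => Real.exp_pos _) hA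

theorem sum_gibbs (hA : (Fintype.piFinset A).Nonempty) (β : ℝ) :
    ∑ a ∈ Fintype.piFinset A, gibbs A Φ β a = 1 := by
  unfold gibbs
  rw [← Finset.sum_div, div_self (partition_pos hA β).ne']

theorem IsPotential.gibbs_isStationary (hΦ : IsPotential U Φ) (hN : 0 < N)
    (hA : (Fintype.piFinset A).Nonempty) (β : ℝ) : IsStationary A U β (gibbs A Φ β) where
  nonneg a _ := div_nonneg (Real.exp_pos _).le (partition_pos hA β).le
  sum_eq_one := sum_gibbs hA β
  balance a' ha' := by
    have : ∀ a ∈ Fintype.piFinset A, gibbs A Φ β a * transition A U β a a' =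
        gibbs A Φ β a' * transition A U β a' a := by
      intro a ha
      unfold gibbs
      rw [div_mul_eq_mul_div, div_mul_eq_mul_div, hΦ.reversible β ha ha']
    rw [Finset.sum_congr rfl this, ← Finset.mul_sum, sum_transition hN β ha', mul_one]

/-- Uniqueness by the maximum principle. Reversibility makes the density of `π` relative to `exp (β
Φ)` harmonic; equality with the average at a maximum spreads the maximal value to every
one-coordinate update, and such updates connect all profiles. -/
theorem IsPotential.eq_gibbs (hΦ : IsPotential U Φ) (hN : 0 < N)
    (hA : (Fintype.piFinset A).Nonempty) {β : ℝ} {π : Profile N → ℝ}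
    (hπ : IsStationary A U β π) {a : Profile N} (ha : a ∈ Fintype.piFinset A) :
    π a = gibbs A Φ β a := by
  set f : Profile N → ℝ := fun a => π a / Real.exp (β * Φ a) with hf
  have hπf : ∀ a, π a = f a * Real.exp (β * Φ a) := fun a => by
    simp only [hf]; field_simp
  have harm : ∀ a ∈ Fintype.piFinset A,
      ∑ b ∈ Fintype.piFinset A, transition A U β a b * f b = f a := by
    intro a ha
    have h1 : ∀ b ∈ Fintype.piFinset A,
        π b * transition A U β b a = Real.exp (β * Φ a) * (transition A U β a b * f b) := by
      intro b hb
      rw [hπf b]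
      linear_combination f b * hΦ.reversible β hb ha
    have h2 := hπ.balance a ha
    rw [Finset.sum_congr rfl h1, ← Finset.mul_sum, hπf a, mul_comm] at h2
    exact mul_right_cancel₀ (Real.exp_pos _).ne' h2
  obtain ⟨m, hm, hmax⟩ := Finset.exists_max_image _ f hA
  have step : ∀ a ∈ Fintype.piFinset A, f a = f m → ∀ i, ∀ z ∈ A i,
      f (Function.update a i z) = f m := by
    intro a ha hfa i z hz
    by_contra hne
    have hlt : ∑ b ∈ Fintype.piFinset A, transition A U β a b * f b <
        ∑ b ∈ Fintype.piFinset A, transition A U β a b * f m :=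
      Finset.sum_lt_sum
        (fun b hb => mul_le_mul_of_nonneg_left (hmax b hb) (transition_nonneg β ha hb))
        ⟨_, update_mem_piFinset ha hz, mul_lt_mul_of_pos_left
          (lt_of_le_of_ne (hmax _ (update_mem_piFinset ha hz)) hne)
          (transition_update_pos β ha hz)⟩
    rw [harm a ha, ← Finset.sum_mul, sum_transition hN β ha, one_mul, hfa] at hlt
    exact lt_irrefl _ hlt
  have const : ∀ b ∈ Fintype.piFinset A, f b = f m := by
    intro b hb
    -- Walk from `m` to `b` by changing one coordinate at a time.
    have : ∀ s : Finset (Fin N), s.piecewise b m ∈ Fintype.piFinset A ∧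
        f (s.piecewise b m) = f m := by
      intro s
      induction s using Finset.induction_on with
      | empty => simpa using hm
      | insert i s _ ih =>
        rw [Finset.piecewise_insert]
        have hbi := Fintype.mem_piFinset.1 hb i
        exact ⟨update_mem_piFinset ih.1 hbi, step _ ih.1 ih.2 i _ hbi⟩
    simpa using (this Finset.univ).2
  have hsum := hπ.sum_eq_one
  rw [Finset.sum_congr rfl fun b hb => by rw [hπf b, const b hb], ← Finset.mul_sum] at hsum
  rw [hπf a, const a ha, gibbs, eq_div_iff (partition_pos hA β).ne']
  linear_combination Real.exp (β * Φ a) * hsum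

theorem tendsto_exp_mul_of_neg {c : ℝ} (hc : c < 0) :
    Tendsto (fun β : ℝ => Real.exp (β * c)) atTop (𝓝 0) :=
  Real.tendsto_exp_atBot.comp (tendsto_id.atTop_mul_const_of_neg hc)

theorem gibbs_eq_inv (β : ℝ) (a : Profile N) :
    gibbs A Φ β a = (∑ b ∈ Fintype.piFinset A, Real.exp (β * (Φ b - Φ a)))⁻¹ := by
  have : ∀ b, Real.exp (β * (Φ b - Φ a)) = Real.exp (β * Φ b) / Real.exp (β * Φ a) := fun b => by
    rw [← Real.exp_sub]; ring_nf
  simp only [this, gibbs]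
  rw [← Finset.sum_div, inv_div]

/-- In a potential game, the stochastically stable states of log-linear learning are the
maximizers of the potential. -/
theorem IsPotential.mem_LLL_iff (hΦ : IsPotential U Φ) (hN : 0 < N) {a : Profile N} :
    a ∈ LLL A U ↔
      a ∈ Fintype.piFinset A ∧ ∀ b ∈ Fintype.piFinset A, Φ b ≤ Φ a := by
  constructor
  · rintro ⟨ha, π, hπ, l, hl, hlim⟩
    refine ⟨ha, fun b hb => ?_⟩
    by_contra! hlt
    have hA : (Fintype.piFinset A).Nonempty := ⟨a, ha⟩
    -- By uniqueness `π β` is the Gibbs distribution, whose mass at `a` is at most `exp (β (Φ a - Φ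
    -- b))`.
    have h0 : Tendsto (fun β => π β a) atTop (𝓝 0) := by
      refine squeeze_zero' ?_ ?_ (tendsto_exp_mul_of_neg (sub_neg.2 hlt))
      · filter_upwards [eventually_gt_atTop 0] with β hβ using (hπ β hβ).nonneg a ha
      · filter_upwards [eventually_gt_atTop 0] with β hβ
        rw [hΦ.eq_gibbs hN hA (hπ β hβ) ha, gibbs, div_le_iff₀ (partition_pos hA β)]
        calc Real.exp (β * Φ a) = Real.exp (β * (Φ a - Φ b)) * Real.exp (β * Φ b) := by
              rw [← Real.exp_add]; ring_nf
          _ ≤ _ := mul_le_mul_of_nonneg_left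
            (Finset.single_le_sum (f := fun b => Real.exp (β * Φ b))
              (fun _ _ => (Real.exp_pos _).le) hb) (Real.exp_pos _).le
    exact hl.ne' (tendsto_nhds_unique hlim h0)
  · rintro ⟨ha, hmax⟩
    have hA : (Fintype.piFinset A).Nonempty := ⟨a, ha⟩
    refine ⟨ha, gibbs A Φ, fun β _ => hΦ.gibbs_isStationary hN hA β, ?_⟩
    -- The Gibbs mass at `a` thus tends to the inverse of the number of maximizers.
    have hterm : ∀ b ∈ Fintype.piFinset A, Tendsto (fun β : ℝ => Real.exp (β * (Φ b - Φ a)))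
        atTop (𝓝 (if Φ b = Φ a then 1 else 0)) := by
      intro b hb
      split_ifs with h
      · simp [h]
      · exact tendsto_exp_mul_of_neg (sub_neg.2 (lt_of_le_of_ne (hmax b hb) h))
    have hpos : (0 : ℝ) < ∑ b ∈ Fintype.piFinset A, if Φ b = Φ a then (1 : ℝ) else 0 :=
      Finset.sum_pos' (fun b _ => by split_ifs <;> norm_num) ⟨a, ha, by simp⟩
    refine ⟨_, inv_pos.2 hpos, ?_⟩
    simp only [gibbs_eq_inv]
    exact (tendsto_finsetSum _ hterm).inv₀ hpos.ne'

theorem IsPotential.LLL_nonempty (hΦ : IsPotential U Φ) (hN : 0 < N)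
    (hA : (Fintype.piFinset A).Nonempty) : (LLL A U).Nonempty := by
  obtain ⟨m, hm, hmax⟩ := Finset.exists_max_image _ Φ hA
  exact ⟨m, (hΦ.mem_LLL_iff hN).2 ⟨hm, hmax⟩⟩

end LogLinear

/-! ### Welfare and potentials -/

section Welfare

variable {N : ℕ} (G : SimpleGraph (Fin N))

open Classical in
/-- The adjacency indicator. -/
noncomputable def weight (i j : Fin N) : ℝ := if G.Adj i j then 1 else 0

theorem weight_nonneg (i j : Fin N) : 0 ≤ weight G i j := by
  unfold weight; split_ifs <;> norm_num

theorem weight_comm (i j : Fin N) : weight G i j = weight G j i := by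
  unfold weight; rw [G.adj_comm]

theorem weight_self (i : Fin N) : weight G i i = 0 := by simp [weight]

theorem weight_of_adj {i j : Fin N} (h : G.Adj i j) : weight G i j = 1 := by simp [weight, h]

theorem payoff_comm (α : ℝ) (c d : Choice) : payoff α c d = payoff α d c := by
  cases c <;> cases d <;> rfl

theorem payoff_nonneg {α : ℝ} (hα : 0 < α) (c d : Choice) : 0 ≤ payoff α c d := by
  cases c <;> cases d <;> simp only [payoff] <;> linarith

theorem payoff_le {α : ℝ} (hα : 0 < α) (c d : Choice) : payoff α c d ≤ 1 + α := by
  cases c <;> cases d <;> simp only [payoff] <;> linarith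

theorem utility_eq (α : ℝ) (i : Fin N) (a : Profile N) :
    utility G α i a = ∑ j, weight G i j * payoff α (a i) (a j) := by
  classical
  simp only [utility, weight, Finset.sum_filter, ite_mul, one_mul, zero_mul]

theorem welfare_eq (α : ℝ) (a : Profile N) :
    welfare α G a = ∑ i, ∑ j, weight G i j * payoff α (a i) (a j) := by
  simp only [welfare, utility_eq]

theorem welfare_nonneg {α : ℝ} (hα : 0 < α) (a : Profile N) : 0 ≤ welfare α G a := by
  rw [welfare_eq]
  exact Finset.sum_nonneg fun i _ => Finset.sum_nonneg fun j _ =>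
    mul_nonneg (weight_nonneg G i j) (payoff_nonneg hα _ _)

theorem welfare_le_const_x {α : ℝ} (hα : 0 < α) (a : Profile N) :
    welfare α G a ≤ welfare α G fun _ => Choice.x := by
  rw [welfare_eq, welfare_eq]
  exact Finset.sum_le_sum fun i _ => Finset.sum_le_sum fun j _ =>
    mul_le_mul_of_nonneg_left (payoff_le hα _ _) (weight_nonneg G i j)

/-- Only edges at `i` change, and the welfare counts each of them from both ends; hence the factor
`2`, and the potential `welfare / 2`. -/
theorem welfare_update_sub (α : ℝ) (i : Fin N) (a : Profile N) (z z' : Choice) :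
    welfare α G (Function.update a i z) - welfare α G (Function.update a i z') =
      2 * (utility G α i (Function.update a i z) - utility G α i (Function.update a i z')) := by
  set D : Fin N → ℝ := fun j => weight G i j *
    (payoff α (Function.update a i z i) (Function.update a i z j) -
      payoff α (Function.update a i z' i) (Function.update a i z' j)) with hD
  have h : ∀ k j, weight G k j * payoff α (Function.update a i z k) (Function.update a i z j) -
      weight G k j * payoff α (Function.update a i z' k) (Function.update a i z' j) =
      (if k = i then D j else 0) + (if j = i then D k else 0) := by
    intro k j
    by_cases hk : k = i
    · subst hk
      by_cases hj : j = k
      · subst hj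
        simp [hD, weight_self]
      · simp only [hD, hj, if_true, if_false]; ring
    · by_cases hj : j = i
      · subst hj
        simp only [hD, hk, if_true, if_false]
        rw [weight_comm G k j, payoff_comm α (Function.update a j z k),
          payoff_comm α (Function.update a j z' k)]
        ring
      · simp [hk, hj]
  have hU : utility G α i (Function.update a i z) - utility G α i (Function.update a i z') =
      ∑ j, D j := by
    rw [utility_eq, utility_eq, ← Finset.sum_sub_distrib]
    exact Finset.sum_congr rfl fun j _ => by simp only [hD]; ring
  rw [hU, welfare_eq, welfare_eq, ← Finset.sum_sub_distrib]
  simp only [← Finset.sum_sub_distrib, h, Finset.sum_add_distrib]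
  rw [Finset.sum_comm]
  simp
  ring

theorem isPotential_welfare (α : ℝ) :
    IsPotential (utility G α) fun a => welfare α G a / 2 := by
  intro i a z z'
  have := welfare_update_sub G α i a z z'
  linear_combination this / 2

/-- The payoff of agent `i` against its imposter. -/
def imposterPayoff (α : ℝ) (S : TargetSet N) (i : Fin N) (c : Choice) : ℝ :=
  (if i ∈ S.Sy then (if c = Choice.y then 1 else 0) else 0)
    + (if i ∈ S.Sx then (1 + α) * (if c = Choice.x then 1 else 0) else 0)

/-- The potential of the game perceived under a broad attack. -/
noncomputable def broadPotential (α : ℝ) (S : TargetSet N) (a : Profile N) : ℝ :=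
  welfare α G a / 2 + ∑ i, imposterPayoff α S i (a i)

theorem isPotential_broadPotential (α : ℝ) (S : TargetSet N) :
    IsPotential (perceivedUtility G α S) (broadPotential G α S) := by
  intro i a z z'
  have h := welfare_update_sub G α i a z z'
  have hs : ∑ k, imposterPayoff α S k (Function.update a i z k) -
      ∑ k, imposterPayoff α S k (Function.update a i z' k) =
      imposterPayoff α S i z - imposterPayoff α S i z' := by
    rw [← Finset.sum_sub_distrib, Finset.sum_eq_single i]
    · simp
    · intro k _ hk
      simp [hk]
    · simp
  have hp : ∀ z, perceivedUtility G α S i (Function.update a i z) =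
      utility G α i (Function.update a i z) + imposterPayoff α S i z := by
    intro z
    simp [perceivedUtility, imposterPayoff, add_assoc]
  rw [hp, hp]
  unfold broadPotential
  linear_combination h / 2 + hs

end Welfare

/-! ### Efficiency -/

section Efficiency

variable {N : ℕ} {αsys : ℝ} {G : SimpleGraph (Fin N)} {A : Fin N → Finset Choice}
  {U : Fin N → Profile N → ℝ}

theorem bddAbove_welfare : BddAbove (welfare αsys G '' (Fintype.piFinset A : Set (Profile N))) :=
  (Set.toFinite _).bddAbove

theorem sSup_welfare_nonneg (hs : 0 < αsys) :
    0 ≤ sSup (welfare αsys G '' (Fintype.piFinset A : Set (Profile N))) :=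
  Real.sSup_nonneg (by rintro _ ⟨a, _, rfl⟩; exact welfare_nonneg G hs a)

theorem sInf_welfare_nonneg (hs : 0 < αsys) : 0 ≤ sInf (welfare αsys G '' LLL A U) :=
  Real.sInf_nonneg (by rintro _ ⟨a, _, rfl⟩; exact welfare_nonneg G hs a)

theorem efficiency_nonneg (hs : 0 < αsys) : 0 ≤ efficiency αsys G A U :=
  div_nonneg (sInf_welfare_nonneg hs) (sSup_welfare_nonneg hs)

theorem efficiency_le_div (hs : 0 < αsys) {a : Profile N} (ha : a ∈ LLL A U) :
    efficiency αsys G A U ≤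
      welfare αsys G a / sSup (welfare αsys G '' (Fintype.piFinset A : Set (Profile N))) :=
  div_le_div_of_nonneg_right (csInf_le (Set.toFinite _).bddBelow ⟨a, ha, rfl⟩)
    (sSup_welfare_nonneg hs)

theorem efficiency_le_one (hs : 0 < αsys) : efficiency αsys G A U ≤ 1 := by
  rcases (LLL A U).eq_empty_or_nonempty with h | ⟨a, ha⟩
  -- The infimum over the empty set is `0` by default.
  · simp [efficiency, h]
  · exact (efficiency_le_div hs ha).trans <|
      div_le_one_of_le₀ (le_csSup bddAbove_welfare ⟨a, ha.1, rfl⟩) (sSup_welfare_nonneg hs)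

theorem exists_efficiency_eq_div (h : (LLL A U).Nonempty) :
    ∃ a ∈ LLL A U, efficiency αsys G A U =
      welfare αsys G a / sSup (welfare αsys G '' (Fintype.piFinset A : Set (Profile N))) := by
  obtain ⟨a, ha, hw⟩ := (h.image (welfare αsys G)).csInf_mem (Set.toFinite _)
  exact ⟨a, ha, by rw [efficiency, hw]⟩

theorem sSup_welfare_univ (hs : 0 < αsys) :
    sSup (welfare αsys G ''
      (Fintype.piFinset (fun _ => Finset.univ : Fin N → Finset Choice) : Set (Profile N))) =
      welfare αsys G fun _ => Choice.x := by
  refine IsGreatest.csSup_eq ⟨⟨_, by simp, rfl⟩, ?_⟩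
  rintro _ ⟨a, _, rfl⟩
  exact welfare_le_const_x G hs a

end Efficiency

/-! ### Focused attacks: monotonicity of the risk in the gain -/

section Focused

variable {N : ℕ} (G : SimpleGraph (Fin N))

theorem payoff_add_sub (α δ : ℝ) (c d : Choice) :
    payoff (α + δ) c d = payoff α c d + δ * (payoff 1 c d - payoff 0 c d) := by
  cases c <;> cases d <;> simp only [payoff] <;> ring

theorem welfare_affine (α α' : ℝ) (a : Profile N) :
    welfare α' G a = welfare α G a + (α' - α) * (welfare 1 G a - welfare 0 G a) := by
  simp only [welfare_eq, ← Finset.sum_sub_distrib, Finset.mul_sum, ← Finset.sum_add_distrib]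
  refine Finset.sum_congr rfl fun i _ => Finset.sum_congr rfl fun j _ => ?_
  have := payoff_add_sub α (α' - α) (a i) (a j)
  rw [add_sub_cancel] at this
  rw [this]; ring

theorem FixedSet.actions_nonempty (F : FixedSet N) : (Fintype.piFinset F.actions).Nonempty := by
  rw [Fintype.piFinset_nonempty]
  intro i
  unfold FixedSet.actions
  split_ifs
  · simp
  · simp
  · exact ⟨Choice.x, by simp⟩

/-- Let `a` be a worst maximizer at `α` and `b` any maximizer at `α'`. Adding the two optimality
inequalities shows that the slope of the welfare in the gain is at least as large at `b` as at `a`.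
Extrapolating `W(b) ≤ W(a)` from `α` down to `αsys ≤ α` preserves it. The normalizing maximum does
not depend on the gain. -/
theorem focusedRisk_mono {αsys α α' : ℝ} (hN : 0 < N) (hs : 0 < αsys) (h : αsys ≤ α) (h' : α ≤ α')
    (F : FixedSet N) : focusedRisk αsys G F α ≤ focusedRisk αsys G F α' := by
  rcases h'.eq_or_lt with rfl | hlt
  · exact le_rfl
  have hne := (isPotential_welfare G α).LLL_nonempty hN F.actions_nonempty
  obtain ⟨a, ha, hea⟩ := exists_efficiency_eq_div (αsys := αsys) (G := G) hne
  obtain ⟨b, hb⟩ := (isPotential_welfare G α').LLL_nonempty hN F.actions_nonempty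
  have hle := efficiency_le_div (G := G) hs hb
  have ha' := ((isPotential_welfare G α).mem_LLL_iff hN).1 ha
  have hb' := ((isPotential_welfare G α').mem_LLL_iff hN).1 hb
  have h1 := ha'.2 b hb'.1
  have h2 := hb'.2 a ha'.1
  have hw : welfare αsys G b ≤ welfare αsys G a := by
    rw [welfare_affine G αsys α, welfare_affine G αsys α] at h1
    rw [welfare_affine G αsys α', welfare_affine G αsys α'] at h2
    have h3 : 0 ≤ (α' - α) *
        ((welfare 1 G b - welfare 0 G b) - (welfare 1 G a - welfare 0 G a)) := by
      linarith
    have h4 := nonneg_of_mul_nonneg_right h3 (sub_pos.2 hlt)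
    have h5 := mul_nonneg (sub_nonneg.2 h) h4
    linarith
  unfold focusedRisk
  rw [hea]
  have := div_le_div_of_nonneg_right hw
    (sSup_welfare_nonneg (αsys := αsys) (G := G) (A := F.actions) hs)
  linarith

end Focused

/-! ### Stars with a `y`-centre, `e` leaves playing `y` and `c` leaves playing `x` -/

section Star

variable (e c : ℕ)

/-- The centre and the first `e` leaves play `y`, the other `c` leaves play `x`. -/
def starProfile : Profile (e + c + 1) :=
  Fin.cons Choice.y fun i : Fin (e + c) => if (i : ℕ) < e then Choice.y else Choice.x

/-- The target set whose imposters agree with `starProfile`. -/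
def starTarget : TargetSet (e + c + 1) where
  Sx := Finset.univ.filter fun i => starProfile e c i = Choice.x
  Sy := Finset.univ.filter fun i => starProfile e c i = Choice.y
  disj := by
    rw [Finset.disjoint_filter]
    intro i _ h
    simp [h]
  cover := by
    ext i
    cases h : starProfile e c i <;> simp [h]

theorem sum_leaves (f : Fin (e + c) → ℝ) :
    ∑ i, f i = ∑ i, f (Fin.castAdd c i) + ∑ i, f (Fin.natAdd e i) :=
  Fin.sum_univ_add f

theorem welfare_star (n : ℕ) (α : ℝ) (a : Profile (n + 1)) :
    welfare α (SimpleGraph.starGraph 0) a = 2 * ∑ i : Fin n, payoff α (a 0) (a i.succ) := by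
  have h0 : ∀ i : Fin n, weight (SimpleGraph.starGraph (0 : Fin (n + 1))) 0 i.succ = 1 := by
    intro i
    exact weight_of_adj _ (SimpleGraph.starGraph_center_adj (Fin.succ_ne_zero i).symm)
  have h1 : ∀ i j : Fin n,
      weight (SimpleGraph.starGraph (0 : Fin (n + 1))) i.succ j.succ = 0 := by
    intro i j
    simp [weight]
  simp only [welfare_eq, Fin.sum_univ_succ, weight_self, h0, h1, weight_comm _ (Fin.succ _) 0]
  simp only [payoff_comm α (a (Fin.succ _)) (a 0)]
  simp
  ring

theorem welfare_starProfile (α : ℝ) :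
    welfare α (SimpleGraph.starGraph 0) (starProfile e c) = 2 * e := by
  rw [welfare_star, sum_leaves]
  simp [starProfile, payoff]

theorem welfare_star_const_x (α : ℝ) :
    welfare α (SimpleGraph.starGraph (0 : Fin (e + c + 1))) (fun _ => Choice.x) =
      2 * ((1 + α) * (e + c)) := by
  rw [welfare_star]
  simp [payoff]
  ring

theorem imposterPayoff_starTarget (α : ℝ) (i : Fin (e + c + 1)) (d : Choice) :
    imposterPayoff α (starTarget e c) i d =
      (if starProfile e c i = Choice.y then (if d = Choice.y then 1 else 0) else 0) +
      (if starProfile e c i = Choice.x then (1 + α) * (if d = Choice.x then 1 else 0) else 0) := by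
  have hy : i ∈ (starTarget e c).Sy ↔ starProfile e c i = Choice.y := by
    simp [starTarget, Finset.mem_filter]
  have hx : i ∈ (starTarget e c).Sx ↔ starProfile e c i = Choice.x := by
    simp [starTarget, Finset.mem_filter]
  simp only [imposterPayoff, hy, hx]

theorem starProfile_zero : starProfile e c 0 = Choice.y := rfl

theorem starProfile_castAdd (i : Fin e) :
    starProfile e c (Fin.castAdd c i).succ = Choice.y := by
  simp [starProfile]

theorem starProfile_natAdd (i : Fin c) :
    starProfile e c (Fin.natAdd e i).succ = Choice.x := by
  simp [starProfile]

theorem broadPotential_star (α : ℝ) (a : Profile (e + c + 1)) :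
    broadPotential (SimpleGraph.starGraph 0) α (starTarget e c) a =
      (if a 0 = Choice.y then 1 else 0) +
      ∑ i : Fin e, (payoff α (a 0) (a (Fin.castAdd c i).succ) +
        if a (Fin.castAdd c i).succ = Choice.y then 1 else 0) +
      ∑ i : Fin c, (payoff α (a 0) (a (Fin.natAdd e i).succ) +
        (1 + α) * if a (Fin.natAdd e i).succ = Choice.x then 1 else 0) := by
  rw [broadPotential, welfare_star, Fin.sum_univ_succ, sum_leaves, sum_leaves]
  simp only [imposterPayoff_starTarget, starProfile_zero, starProfile_castAdd, starProfile_natAdd,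
    Finset.sum_add_distrib, if_true, reduceCtorEq, if_false, Finset.sum_const_zero]
  ring

variable {e c}

/-- Once the action of the centre is fixed, the leaves optimize independently. The hypothesis is
exactly the comparison of the two optima, `(1 + α) e + 2 (1 + α) c` for `x` and `1 + 2 e + (1 + α)
c` for `y`. -/
theorem starProfile_mem_LLL {α : ℝ} (hα : 0 < α) (h : α * e + (1 + α) * c ≤ e + 1) :
    starProfile e c ∈ LLL (fun _ => Finset.univ)
      (perceivedUtility (SimpleGraph.starGraph 0) α (starTarget e c)) := by
  rw [(isPotential_broadPotential _ α _).mem_LLL_iff (Nat.succ_pos _)]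
  refine ⟨by simp, fun a _ => ?_⟩
  have hv : broadPotential (SimpleGraph.starGraph 0) α (starTarget e c) (starProfile e c) =
      1 + e * 2 + c * (1 + α) := by
    rw [broadPotential_star]
    simp [starProfile, payoff]
    ring
  rw [hv, broadPotential_star]
  rcases ha : a 0 with _ | _
  · have h1 : ∀ i ∈ (Finset.univ : Finset (Fin e)),
        payoff α Choice.x (a (Fin.castAdd c i).succ) +
        (if a (Fin.castAdd c i).succ = Choice.y then 1 else 0) ≤ 1 + α := by
      intro i _
      cases a (Fin.castAdd c i).succ <;> simp [payoff]; linarith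
    have h2 : ∀ i ∈ (Finset.univ : Finset (Fin c)),
        payoff α Choice.x (a (Fin.natAdd e i).succ) +
        (1 + α) * (if a (Fin.natAdd e i).succ = Choice.x then 1 else 0) ≤ 2 * (1 + α) := by
      intro i _
      cases a (Fin.natAdd e i).succ <;> simp [payoff] <;> linarith
    have h3 := Finset.sum_le_sum h1
    have h4 := Finset.sum_le_sum h2
    simp only [Finset.sum_const, Finset.card_univ, Fintype.card_fin, nsmul_eq_mul] at h3 h4
    simp only [reduceCtorEq, if_false]
    linarith
  · have h1 : ∀ i ∈ (Finset.univ : Finset (Fin e)),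
        payoff α Choice.y (a (Fin.castAdd c i).succ) +
        (if a (Fin.castAdd c i).succ = Choice.y then 1 else 0) ≤ 2 := by
      intro i _
      cases a (Fin.castAdd c i).succ <;> simp [payoff]; norm_num
    have h2 : ∀ i ∈ (Finset.univ : Finset (Fin c)),
        payoff α Choice.y (a (Fin.natAdd e i).succ) +
        (1 + α) * (if a (Fin.natAdd e i).succ = Choice.x then 1 else 0) ≤ 1 + α := by
      intro i _
      cases a (Fin.natAdd e i).succ <;> simp [payoff]; linarith
    have h3 := Finset.sum_le_sum h1
    have h4 := Finset.sum_le_sum h2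
    simp only [Finset.sum_const, Finset.card_univ, Fintype.card_fin, nsmul_eq_mul] at h3 h4
    simp only [if_true]
    linarith

theorem le_broadRisk_star {αsys α : ℝ} (hs : 0 < αsys) (hα : 0 < α)
    (h : α * e + (1 + α) * c ≤ e + 1) :
    1 - e / ((1 + αsys) * (e + c)) ≤
      broadRisk αsys (SimpleGraph.starGraph 0) (starTarget e c) α := by
  have hle := efficiency_le_div (G := SimpleGraph.starGraph 0) hs (starProfile_mem_LLL hα h)
  rw [sSup_welfare_univ hs, welfare_starProfile, welfare_star_const_x,
    mul_div_mul_left _ _ two_ne_zero] at hle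
  unfold broadRisk
  linarith

end Star

/-! ### Broad attacks: reduction to stars -/

section Reduction

variable {N : ℕ} (G : SimpleGraph (Fin N))

/-- The number of ordered adjacent pairs in `P ×ˢ Q`. -/
noncomputable def edgeCount (P Q : Finset (Fin N)) : ℝ :=
  ∑ i, ∑ j, if i ∈ P ∧ j ∈ Q then weight G i j else 0

theorem edgeCount_nonneg (P Q : Finset (Fin N)) : 0 ≤ edgeCount G P Q :=
  Finset.sum_nonneg fun i _ => Finset.sum_nonneg fun j _ => by
    split_ifs
    · exact weight_nonneg G i j
    · exact le_rfl

theorem edgeCount_comm (P Q : Finset (Fin N)) : edgeCount G P Q = edgeCount G Q P := by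
  unfold edgeCount
  rw [Finset.sum_comm]
  refine Finset.sum_congr rfl fun i _ => Finset.sum_congr rfl fun j _ => ?_
  simp only [weight_comm G j i, and_comm]

theorem exists_edgeCount_eq_natCast (P Q : Finset (Fin N)) : ∃ c : ℕ, edgeCount G P Q = c := by
  classical
  refine ⟨∑ i, ∑ j, if i ∈ P ∧ j ∈ Q then (if G.Adj i j then 1 else 0) else 0, ?_⟩
  push_cast
  unfold edgeCount weight
  refine Finset.sum_congr rfl fun i _ => Finset.sum_congr rfl fun j _ => ?_
  split_ifs <;> rfl

theorem edgeCount_sdiff {T P : Finset (Fin N)} (hP : P ⊆ T) (Q : Finset (Fin N)) :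
    edgeCount G T Q = edgeCount G P Q + edgeCount G (T \ P) Q := by
  simp only [edgeCount, ← Finset.sum_add_distrib]
  refine Finset.sum_congr rfl fun i _ => Finset.sum_congr rfl fun j _ => ?_
  have := @hP i
  by_cases h1 : i ∈ P <;> by_cases h2 : i ∈ T <;> by_cases h3 : j ∈ Q <;> simp_all

theorem edgeCount_eq_zero {P Q : Finset (Fin N)} (h : ∀ i ∈ P, ∀ j ∈ Q, ¬ G.Adj i j) :
    edgeCount G P Q = 0 := by
  refine Finset.sum_eq_zero fun i _ => Finset.sum_eq_zero fun j _ => ?_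
  split_ifs with hij
  · simp [weight, h i hij.1 j hij.2]
  · rfl

theorem one_le_edgeCount {P Q : Finset (Fin N)} {i j : Fin N} (hi : i ∈ P) (hj : j ∈ Q)
    (h : G.Adj i j) : 1 ≤ edgeCount G P Q := by
  have hnn : ∀ i j, 0 ≤ if i ∈ P ∧ j ∈ Q then weight G i j else 0 := fun i j => by
    split_ifs
    · exact weight_nonneg G i j
    · exact le_rfl
  calc (1 : ℝ) = if i ∈ P ∧ j ∈ Q then weight G i j else 0 := by
        rw [if_pos ⟨hi, hj⟩, weight_of_adj G h]
    _ ≤ ∑ j, if i ∈ P ∧ j ∈ Q then weight G i j else 0 :=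
        Finset.single_le_sum (f := fun j => if i ∈ P ∧ j ∈ Q then weight G i j else 0)
          (fun j _ => hnn i j) (Finset.mem_univ j)
    _ ≤ edgeCount G P Q :=
        Finset.single_le_sum (f := fun i => ∑ j, if i ∈ P ∧ j ∈ Q then weight G i j else 0)
          (fun i _ => Finset.sum_nonneg fun j _ => hnn i j) (Finset.mem_univ i)

theorem edgeCount_insert_self {P : Finset (Fin N)} {j : Fin N} (hj : j ∉ P) :
    edgeCount G (insert j P) (insert j P) = edgeCount G P P + 2 * edgeCount G P {j} := by
  have h : edgeCount G (insert j P) (insert j P) =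
      edgeCount G P P + edgeCount G P {j} + edgeCount G {j} P := by
    simp only [edgeCount, ← Finset.sum_add_distrib]
    refine Finset.sum_congr rfl fun k _ => Finset.sum_congr rfl fun l _ => ?_
    by_cases hk : k = j
    · subst hk
      by_cases hl : l = k
      · subst hl; simp [weight_self]
      · simp [hj, hl]
    · by_cases hl : l = j
      · subst hl; simp [hk, hj]
      · simp [hk, hl]
  rw [h, edgeCount_comm G {j} P]
  ring

/-- A connected set of `n` nodes spans at least `n - 1` edges. -/
theorem two_mul_card_sub_one_le_edgeCount {T : Finset (Fin N)} (hT : T.Nonempty)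
    (hconn : ∀ P ⊆ T, P.Nonempty → P ≠ T → ∃ i ∈ P, ∃ j ∈ T \ P, G.Adj i j) :
    2 * ((T.card : ℝ) - 1) ≤ edgeCount G T T := by
  -- Grow a subset node by node; each new node brings an edge to the old ones, that is, two ordered
  -- pairs.
  have key : ∀ n : ℕ, n + 1 ≤ T.card →
      ∃ P ⊆ T, P.card = n + 1 ∧ 2 * (n : ℝ) ≤ edgeCount G P P := by
    intro n
    induction n with
    | zero =>
      intro _
      obtain ⟨i, hi⟩ := hT
      exact ⟨{i}, by simpa using hi, by simp, by simpa using edgeCount_nonneg G _ _⟩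
    | succ n ih =>
      intro hn
      obtain ⟨P, hPT, hP, hle⟩ := ih (by omega)
      obtain ⟨i, hi, j, hj, hadj⟩ := hconn P hPT (Finset.card_pos.1 (by omega))
        (by rintro rfl; omega)
      rw [Finset.mem_sdiff] at hj
      refine ⟨insert j P, Finset.insert_subset hj.1 hPT, ?_, ?_⟩
      · rw [Finset.card_insert_of_notMem hj.2, hP]
      · rw [edgeCount_insert_self G hj.2]
        have := one_le_edgeCount G hi (Finset.mem_singleton_self j) hadj
        push_cast
        linarith
  have hc := hT.card_pos
  obtain ⟨P, hPT, hP, hle⟩ := key (T.card - 1) (by omega)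
  have : P = T := Finset.eq_of_subset_of_card_le hPT (by omega)
  subst this
  rwa [Nat.cast_sub hc, Nat.cast_one] at hle

/-- A connected component of `Y` whose number of boundary edges, relative to the number of inner
edges, is at least that of `Y`. -/
theorem exists_component (Y : Finset (Fin N)) (hY : Y.Nonempty) :
    ∃ T ⊆ Y, T.Nonempty ∧ (∀ i ∈ T, ∀ j ∈ Y \ T, ¬ G.Adj i j) ∧
      edgeCount G T Y * edgeCount G Y Yᶜ ≤ edgeCount G Y Y * edgeCount G T Yᶜ ∧
      ∀ P ⊆ T, P.Nonempty → P ≠ T → ∃ i ∈ P, ∃ j ∈ T \ P, G.Adj i j := by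
  classical
  -- A smallest nonempty union of components satisfying the ratio inequality is connected.
  obtain ⟨T, hT, hmin⟩ := Finset.exists_min_image (Y.powerset.filter fun T => T.Nonempty ∧
      (∀ i ∈ T, ∀ j ∈ Y \ T, ¬ G.Adj i j) ∧
      edgeCount G T Y * edgeCount G Y Yᶜ ≤ edgeCount G Y Y * edgeCount G T Yᶜ) Finset.card
    ⟨Y, by simp +contextual [hY]⟩
  simp only [Finset.mem_filter, Finset.mem_powerset] at hT hmin
  obtain ⟨hTY, hne, hclosed, hratio⟩ := hT
  refine ⟨T, hTY, hne, hclosed, hratio, fun P hPT hP hPne => ?_⟩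
  by_contra! hcon
  have hss : P ⊂ T := hPT.ssubset_of_ne hPne
  have hd : (T \ P).Nonempty := Finset.sdiff_nonempty.2 hss.2
  have hP1 : ∀ i ∈ P, ∀ j ∈ Y \ P, ¬ G.Adj i j := by
    intro i hi j hj
    by_cases hjT : j ∈ T
    · exact hcon i hi j (by simp_all)
    · exact hclosed i (hPT hi) j (by simp_all)
  have hP2 : ∀ i ∈ T \ P, ∀ j ∈ Y \ (T \ P), ¬ G.Adj i j := by
    intro i hi j hj
    by_cases hjT : j ∈ T
    · exact fun h => hcon j (by simp_all) i hi h.symm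
    · exact hclosed i (Finset.mem_sdiff.1 hi).1 j (by simp_all)
  -- If `T` split into `P` and `T \ P`, minimality would make both violate the ratio inequality;
  -- adding the two violations contradicts it for `T`.
  have h1 : edgeCount G Y Y * edgeCount G P Yᶜ < edgeCount G P Y * edgeCount G Y Yᶜ := by
    by_contra! h
    exact absurd (hmin P ⟨hPT.trans hTY, hP, hP1, h⟩) (not_le.2 (Finset.card_lt_card hss))
  have h2 : edgeCount G Y Y * edgeCount G (T \ P) Yᶜ <
      edgeCount G (T \ P) Y * edgeCount G Y Yᶜ := by
    by_contra! h
    exact absurd (hmin (T \ P) ⟨Finset.sdiff_subset.trans hTY, hd, hP2, h⟩)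
      (not_le.2 (Finset.card_lt_card (Finset.sdiff_ssubset hPT hP)))
  rw [edgeCount_sdiff G hPT, edgeCount_sdiff G hPT] at hratio
  linarith

/-- The nodes that play `y`. -/
def yNodes (a : Profile N) : Finset (Fin N) := Finset.univ.filter fun i => a i = Choice.y

theorem mem_yNodes {a : Profile N} {i : Fin N} : i ∈ yNodes a ↔ a i = Choice.y := by
  simp [yNodes]

theorem welfare_eq_edgeCount (α : ℝ) (a : Profile N) :
    welfare α G a = (1 + α) * edgeCount G (yNodes a)ᶜ (yNodes a)ᶜ +
      edgeCount G (yNodes a) (yNodes a) := by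
  simp only [welfare_eq, edgeCount, Finset.mul_sum, ← Finset.sum_add_distrib]
  refine Finset.sum_congr rfl fun i _ => Finset.sum_congr rfl fun j _ => ?_
  rcases hi : a i with _ | _ <;> rcases hj : a j with _ | _ <;>
    simp [mem_yNodes, hi, hj, payoff, mul_comm]

theorem welfare_const_x_eq_edgeCount (α : ℝ) (Y : Finset (Fin N)) :
    welfare α G (fun _ => Choice.x) = (1 + α) * (edgeCount G Yᶜ Yᶜ +
      edgeCount G Y Y + 2 * edgeCount G Y Yᶜ) := by
  have h : welfare α G (fun _ => Choice.x) = (1 + α) * (edgeCount G Yᶜ Yᶜ +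
      edgeCount G Y Y + edgeCount G Y Yᶜ + edgeCount G Yᶜ Y) := by
    simp only [welfare_eq, edgeCount, ← Finset.sum_add_distrib]
    simp only [Finset.mul_sum]
    refine Finset.sum_congr rfl fun i _ => Finset.sum_congr rfl fun j _ => ?_
    by_cases hi : i ∈ Y <;> by_cases hj : j ∈ Y <;> simp [hi, hj, payoff, mul_comm]
  rw [h, edgeCount_comm G Yᶜ Y]
  ring

/-- If a profile maximizes the perceived potential, then converting a union of components of the
`y`-nodes to `x` does not increase it. -/
theorem component_le_card {α : ℝ} (hα : 0 < α) {S : TargetSet N} {a : Profile N}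
    (hmax : ∀ b, broadPotential G α S b ≤ broadPotential G α S a) {T : Finset (Fin N)}
    (hTY : T ⊆ yNodes a) (hclosed : ∀ i ∈ T, ∀ j ∈ yNodes a \ T, ¬ G.Adj i j) :
    α * (edgeCount G T (yNodes a) / 2) + (1 + α) * edgeCount G T (yNodes a)ᶜ ≤ T.card := by
  -- Turning `T` to `x` changes only edges meeting `T`, as `T` has no edge to the other `y`-nodes,
  -- and costs at most `1` per imposter.
  set b : Profile N := fun i => if i ∈ T then Choice.x else a i with hb
  have hwel : welfare α G b - welfare α G a = α * edgeCount G T (yNodes a) +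
      (1 + α) * edgeCount G T (yNodes a)ᶜ + (1 + α) * edgeCount G (yNodes a)ᶜ T := by
    simp only [welfare_eq, edgeCount, Finset.mul_sum, ← Finset.sum_add_distrib,
      ← Finset.sum_sub_distrib]
    refine Finset.sum_congr rfl fun i _ => Finset.sum_congr rfl fun j _ => ?_
    have hTi : i ∈ T → a i = Choice.y := fun h => mem_yNodes.1 (hTY h)
    have hTj : j ∈ T → a j = Choice.y := fun h => mem_yNodes.1 (hTY h)
    have hij : i ∈ T → j ∉ T → a j = Choice.y → weight G i j = 0 := fun h1 h2 h3 => by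
      simp [weight, hclosed i h1 j (by simp [mem_yNodes, h2, h3])]
    have hji : j ∈ T → i ∉ T → a i = Choice.y → weight G i j = 0 := fun h1 h2 h3 => by
      rw [weight_comm]
      simp [weight, hclosed j h1 i (by simp [mem_yNodes, h2, h3])]
    by_cases hi : i ∈ T
    · have hai := hTi hi
      by_cases hj : j ∈ T
      · have haj := hTj hj
        simp [hb, hi, hj, mem_yNodes, hai, haj, payoff]; ring
      · rcases haj : a j with _ | _
        · simp [hb, hi, hj, mem_yNodes, hai, haj, payoff]; ring
        · simp [hij hi hj haj]
    · by_cases hj : j ∈ T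
      · have haj := hTj hj
        rcases hai : a i with _ | _
        · simp [hb, hi, hj, mem_yNodes, hai, haj, payoff]; ring
        · simp [hji hj hi hai]
      · simp [hb, hi, hj]
  have himp : ∑ i, imposterPayoff α S i (a i) - ∑ i, imposterPayoff α S i (b i) ≤ T.card := by
    rw [← Finset.sum_sub_distrib]
    have : (T.card : ℝ) = ∑ i, if i ∈ T then (1 : ℝ) else 0 := by simp
    rw [this]
    refine Finset.sum_le_sum fun i _ => ?_
    by_cases hi : i ∈ T
    · have hai : a i = Choice.y := mem_yNodes.1 (hTY hi)
      simp only [hb, hi, if_true, hai, imposterPayoff, reduceCtorEq, if_false]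
      split_ifs <;> linarith
    · simp [hb, hi]
  have hm := hmax b
  rw [edgeCount_comm G (yNodes a)ᶜ T] at hwel
  unfold broadPotential at hm
  linarith

theorem eq_univ_of_connected {G : SimpleGraph (Fin N)} (hG : G.Connected) {T : Finset (Fin N)}
    (hT : T.Nonempty) (h : ∀ i ∈ T, ∀ j ∉ T, ¬ G.Adj i j) : T = Finset.univ := by
  obtain ⟨u, hu⟩ := hT
  by_contra hne
  obtain ⟨v, hv⟩ : ∃ v, v ∉ T := by
    by_contra! hall
    exact hne (Finset.eq_univ_iff_forall.2 hall)
  obtain ⟨p⟩ := hG.preconnected u v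
  obtain ⟨d, _, h1, h2⟩ := p.exists_boundary_dart (T : Set (Fin N)) hu hv
  exact h _ h1 _ h2 d.adj

theorem welfare_const_x_pos {G : SimpleGraph (Fin N)} (hG : G.Connected) (hN : 3 ≤ N) {α : ℝ}
    (hα : 0 < α) : 0 < welfare α G fun _ => Choice.x := by
  obtain ⟨i, j, hadj⟩ : ∃ i j, G.Adj i j := by
    by_contra! h
    have h1 : ({⟨0, by omega⟩} : Finset (Fin N)) = Finset.univ :=
      eq_univ_of_connected hG (by simp) fun i _ j _ => h i j
    have h2 : (Finset.univ : Finset (Fin N)).card = N := by simp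
    rw [← h1, Finset.card_singleton] at h2
    omega
  have h3 := one_le_edgeCount G (Finset.mem_univ i) (Finset.mem_univ j) hadj
  have h4 := edgeCount_nonneg G (Finset.univ : Finset (Fin N))ᶜ Finset.univᶜ
  have h5 := edgeCount_nonneg G (Finset.univ : Finset (Fin N)) Finset.univᶜ
  rw [welfare_const_x_eq_edgeCount G α Finset.univ]
  apply mul_pos <;> linarith

/-- A profile, other than all-`x`, that maximizes the perceived potential is at least as efficient
as the profile of a star that is subject to a broad attack with the same gain. -/
theorem exists_star_le {G : SimpleGraph (Fin N)} (hG : G.Connected) (hN : 3 ≤ N) {αsys α : ℝ}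
    (hs : 0 < αsys) (hα : 0 < α) {S : TargetSet N} {a : Profile N}
    (hmax : ∀ b, broadPotential G α S b ≤ broadPotential G α S a) (hY : (yNodes a).Nonempty) :
    ∃ e c : ℕ, 2 ≤ e + c ∧ α * e + (1 + α) * c ≤ e + 1 ∧
      e / ((1 + αsys) * (e + c)) ≤ welfare αsys G a / welfare αsys G fun _ => Choice.x := by
  obtain ⟨T, hTY, hT, hclosed, hratio, hconn⟩ := exists_component G _ hY
  have hcard := component_le_card G hα hmax hTY hclosed
  obtain ⟨c, hc⟩ := exists_edgeCount_eq_natCast G T (yNodes a)ᶜ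
  obtain ⟨e, he⟩ : ∃ e : ℕ, T.card = e + 1 :=
    ⟨T.card - 1, (Nat.sub_add_cancel hT.card_pos).symm⟩
  have hd : 2 * (e : ℝ) ≤ edgeCount G T (yNodes a) := by
    have h1 := two_mul_card_sub_one_le_edgeCount G hT hconn
    have h2 : edgeCount G T (yNodes a) = edgeCount G T T + edgeCount G T (yNodes a \ T) := by
      rw [edgeCount_comm G T (yNodes a), edgeCount_sdiff G hTY, edgeCount_comm G _ T]
      rw [edgeCount_comm G (yNodes a \ T) T]
    rw [h2, edgeCount_eq_zero G hclosed, add_zero]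
    rw [he] at h1
    push_cast at h1
    linarith
  rw [hc] at hcard hratio
  have heR : (T.card : ℝ) = e + 1 := by rw [he]; push_cast; ring
  -- Replacing the inner edges of `T` by the spanning-tree count `e` only weakens the inequality.
  have hcond : α * e + (1 + α) * c ≤ e + 1 := by
    rw [← heR]
    have := mul_le_mul_of_nonneg_left hd hα.le
    linarith
  -- The star needs three nodes. If `c = 0`, connectedness makes `T` everything; if `e = 0 < c`, the
  -- condition fails.
  have h2 : 2 ≤ e + c := by
    rcases Nat.eq_zero_or_pos c with rfl | hcpos
    · have : T = Finset.univ := by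
        refine eq_univ_of_connected hG hT fun i hi j hj hadj => ?_
        by_cases hjY : j ∈ yNodes a
        · exact hclosed i hi j (Finset.mem_sdiff.2 ⟨hjY, hj⟩) hadj
        · have := one_le_edgeCount G hi (Finset.mem_compl.2 hjY) hadj
          rw [hc] at this
          norm_num at this
      rw [this, Finset.card_univ, Fintype.card_fin] at he
      omega
    · rcases Nat.eq_zero_or_pos e with rfl | hepos
      · have : (1 : ℝ) ≤ c := by exact_mod_cast hcpos
        have := mul_le_mul_of_nonneg_left this (by linarith : (0 : ℝ) ≤ 1 + α)
        norm_num at hcond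
        linarith
      · omega
  refine ⟨e, c, h2, hcond, ?_⟩
  have h2R : (2 : ℝ) ≤ e + c := by exact_mod_cast h2
  set Y := yNodes a with hYdef
  have hX := edgeCount_nonneg G Yᶜ Yᶜ
  have hD := edgeCount_nonneg G Y Y
  have hC := edgeCount_nonneg G Y Yᶜ
  rw [welfare_const_x_eq_edgeCount G αsys Y, welfare_eq_edgeCount, ← hYdef]
  set X := edgeCount G Yᶜ Yᶜ
  set D := edgeCount G Y Y
  set C := edgeCount G Y Yᶜ
  have hpos : 0 < X + D + 2 * C := by
    have := welfare_const_x_pos hG hN hs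
    rw [welfare_const_x_eq_edgeCount G αsys Y] at this
    exact pos_of_mul_pos_right this (by linarith)
  have he0 : (0 : ℝ) ≤ e := Nat.cast_nonneg e
  have hc0 : (0 : ℝ) ≤ c := Nat.cast_nonneg c
  have hs1 : 0 < 1 + αsys := by linarith
  -- The ratio inequality gives `2 e C ≤ D c`; the remaining terms compare trivially.
  have hmain : e * (X + D + 2 * C) ≤ (e + c) * ((1 + αsys) * X + D) := by
    have e1 : 2 * (e : ℝ) * C ≤ D * c := (mul_le_mul_of_nonneg_right hd hC).trans hratio
    have e2 : 0 ≤ (e : ℝ) * (αsys * X) := by positivity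
    have e3 : 0 ≤ (c : ℝ) * ((1 + αsys) * X) := by positivity
    linarith
  rw [div_le_div_iff₀ (by positivity) (by positivity)]
  have := mul_le_mul_of_nonneg_left hmain hs1.le
  linarith

/-- The dominating instance is chosen before `α'`: a single one must serve all smaller gains at once
for the expectation to be bounded. -/
theorem exists_dominating_broad {G : SimpleGraph (Fin N)} (hG : G.Connected) (hN : 3 ≤ N)
    {αsys α : ℝ} (hs : 0 < αsys) (hα : 0 < α) (S : TargetSet N) :
    ∃ N' : ℕ, 3 ≤ N' ∧ ∃ G' : SimpleGraph (Fin N'), G'.Connected ∧ ∃ S' : TargetSet N',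
      ∀ α', 0 < α' → α' ≤ α → broadRisk αsys G S α ≤ broadRisk αsys G' S' α' := by
  have hN0 : 0 < N := by omega
  obtain ⟨a, ha, hea⟩ := exists_efficiency_eq_div (αsys := αsys) (G := G)
    ((isPotential_broadPotential G α S).LLL_nonempty (A := fun _ => Finset.univ) hN0
      ⟨fun _ => Choice.x, by simp⟩)
  have hmax := (((isPotential_broadPotential G α S).mem_LLL_iff hN0).1 ha).2
  rw [sSup_welfare_univ hs] at hea
  rcases (yNodes a).eq_empty_or_nonempty with hY | hY
  -- At all-`x` the risk is `0`, so any instance dominates.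
  · refine ⟨N, hN, G, hG, S, fun α' _ _ => ?_⟩
    have hax : a = fun _ => Choice.x := by
      funext i
      cases h : a i
      · rfl
      · exact absurd (mem_yNodes.2 h) (by simp [hY])
    rw [hax, div_self (welfare_const_x_pos hG hN hs).ne'] at hea
    have := efficiency_le_one (G := G) (A := fun _ => Finset.univ)
      (U := perceivedUtility G α' S) hs
    unfold broadRisk
    linarith
  · obtain ⟨e, c, h2, hcond, hle⟩ := exists_star_le hG hN hs hα (fun b => hmax b (by simp)) hY
    refine ⟨e + c + 1, by omega, SimpleGraph.starGraph 0, SimpleGraph.connected_starGraph 0,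
      starTarget e c, fun α' h0 h1 => ?_⟩
    have hc' : α' * e + (1 + α') * c ≤ e + 1 := by
      have : α' * (e + c) ≤ α * (e + c) := mul_le_mul_of_nonneg_right h1 (by positivity)
      linarith
    refine le_trans ?_ (le_broadRisk_star hs h0 hc')
    unfold broadRisk
    rw [hea]
    linarith

end Reduction

/-! ### Worst-case risks as suprema over instances -/

section Suprema

/-- The systems: connected graphs on at least three nodes. -/
structure System where
  N : ℕ
  three_le : 3 ≤ N
  G : SimpleGraph (Fin N)
  connected : G.Connected

/-- A system with a broad attack. -/
abbrev BroadInstance := Σ s : System, TargetSet s.N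

/-- A system with a focused attack. -/
abbrev FocusedInstance := Σ s : System, FixedSet s.N

instance : Nonempty BroadInstance :=
  ⟨⟨⟨3, le_rfl, ⊤, SimpleGraph.connected_top⟩, ⟨Finset.univ, ∅, by simp, by simp⟩⟩⟩

instance : Nonempty FocusedInstance :=
  ⟨⟨⟨3, le_rfl, ⊤, SimpleGraph.connected_top⟩, ⟨{0}, ∅, by simp, by simp, by decide⟩⟩⟩

theorem sSup_broad_eq (f : ∀ N : ℕ, SimpleGraph (Fin N) → TargetSet N → ℝ) :
    sSup {r | ∃ N : ℕ, 3 ≤ N ∧ ∃ G : SimpleGraph (Fin N), G.Connected ∧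
      ∃ S : TargetSet N, r = f N G S} = ⨆ x : BroadInstance, f x.1.N x.1.G x.2 := by
  rw [iSup]
  congr 1
  ext r
  constructor
  · rintro ⟨N, hN, G, hG, S, rfl⟩
    exact ⟨⟨⟨N, hN, G, hG⟩, S⟩, rfl⟩
  · rintro ⟨⟨s, S⟩, rfl⟩
    exact ⟨s.N, s.three_le, s.G, s.connected, S, rfl⟩

theorem sSup_focused_eq (f : ∀ N : ℕ, SimpleGraph (Fin N) → FixedSet N → ℝ) :
    sSup {r | ∃ N : ℕ, 3 ≤ N ∧ ∃ G : SimpleGraph (Fin N), G.Connected ∧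
      ∃ S : FixedSet N, r = f N G S} = ⨆ x : FocusedInstance, f x.1.N x.1.G x.2 := by
  rw [iSup]
  congr 1
  ext r
  constructor
  · rintro ⟨N, hN, G, hG, S, rfl⟩
    exact ⟨⟨⟨N, hN, G, hG⟩, S⟩, rfl⟩
  · rintro ⟨⟨s, S⟩, rfl⟩
    exact ⟨s.N, s.three_le, s.G, s.connected, S, rfl⟩

theorem broadRisk_mem_Icc {αsys : ℝ} (hs : 0 < αsys) {N : ℕ} (G : SimpleGraph (Fin N))
    (S : TargetSet N) (α : ℝ) : broadRisk αsys G S α ∈ Set.Icc (0 : ℝ) 1 :=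
  ⟨sub_nonneg.2 (efficiency_le_one hs), sub_le_self _ (efficiency_nonneg hs)⟩

theorem focusedRisk_mem_Icc {αsys : ℝ} (hs : 0 < αsys) {N : ℕ} (G : SimpleGraph (Fin N))
    (F : FixedSet N) (α : ℝ) : focusedRisk αsys G F α ∈ Set.Icc (0 : ℝ) 1 :=
  ⟨sub_nonneg.2 (efficiency_le_one hs), sub_le_self _ (efficiency_nonneg hs)⟩

theorem iSup_mem_Icc {ι : Type*} [Nonempty ι] {f : ι → ℝ} (hf : ∀ x, f x ∈ Set.Icc (0 : ℝ) 1) :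
    (⨆ x, f x) ∈ Set.Icc (0 : ℝ) 1 :=
  ⟨Real.iSup_nonneg fun x => (hf x).1, ciSup_le fun x => (hf x).2⟩

theorem sum_mul_mem_Icc {κ : Type*} [Fintype κ] {p f : κ → ℝ} (hp : p ∈ stdSimplex ℝ κ)
    (hf : ∀ j, f j ∈ Set.Icc (0 : ℝ) 1) : ∑ j, p j * f j ∈ Set.Icc (0 : ℝ) 1 :=
  ⟨Finset.sum_nonneg fun j _ => mul_nonneg (hp.1 j) (hf j).1,
    (Finset.sum_le_sum fun j _ => mul_le_of_le_one_right (hp.1 j) (hf j).2).trans hp.2.le⟩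

/-- If every instance has its risk at `k` matched by the risks of some instance on all of `J`, then
the worst-case expected risk is at least the worst-case risk at `k` times the mass of `J`. -/
theorem iSup_mul_sum_le {ι κ : Type*} [Nonempty ι] [Fintype κ] {R : ι → κ → ℝ}
    (hR : ∀ x j, R x j ∈ Set.Icc (0 : ℝ) 1) {p : κ → ℝ} (hp : p ∈ stdSimplex ℝ κ)
    {J : Finset κ} {k : κ} (h : ∀ x, ∃ x', ∀ j ∈ J, R x k ≤ R x' j) :
    (⨆ x, R x k) * ∑ j ∈ J, p j ≤ ⨆ x, ∑ j, p j * R x j := by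
  have hbdd : BddAbove (Set.range fun x => ∑ j, p j * R x j) :=
    ⟨1, by rintro _ ⟨x, rfl⟩; exact (sum_mul_mem_Icc hp (hR x)).2⟩
  have hJ : 0 ≤ ∑ j ∈ J, p j := Finset.sum_nonneg fun j _ => hp.1 j
  rw [Real.iSup_mul_of_nonneg hJ]
  refine ciSup_le fun x => ?_
  obtain ⟨x', hx'⟩ := h x
  refine le_trans ?_ (le_ciSup hbdd x')
  calc R x k * ∑ j ∈ J, p j = ∑ j ∈ J, p j * R x k := by
        rw [Finset.mul_sum]; exact Finset.sum_congr rfl fun j _ => mul_comm _ _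
    _ ≤ ∑ j ∈ J, p j * R x' j :=
        Finset.sum_le_sum fun j hj => mul_le_mul_of_nonneg_left (hx' j hj) (hp.1 j)
    _ ≤ ∑ j, p j * R x' j :=
        Finset.sum_le_sum_of_subset_of_nonneg (Finset.subset_univ J)
          fun j _ _ => mul_nonneg (hp.1 j) (hR x' j).1

variable {αsys : ℝ} {m : ℕ} {α p : Fin (m + 1) → ℝ}

theorem worstBroadRisk_mem_Icc (hs : 0 < αsys) (β : ℝ) :
    worstBroadRisk αsys β ∈ Set.Icc (0 : ℝ) 1 := by
  rw [worstBroadRisk, sSup_broad_eq fun N G S => broadRisk αsys G S β]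
  exact iSup_mem_Icc fun x => broadRisk_mem_Icc hs _ _ _

theorem worstFocusedRisk_mem_Icc (hs : 0 < αsys) (β : ℝ) :
    worstFocusedRisk αsys β ∈ Set.Icc (0 : ℝ) 1 := by
  rw [worstFocusedRisk, sSup_focused_eq fun N G S => focusedRisk αsys G S β]
  exact iSup_mem_Icc fun x => focusedRisk_mem_Icc hs _ _ _

theorem worstExpectedFocusedRisk_mem_Icc (hs : 0 < αsys) (hp : p ∈ stdSimplex ℝ (Fin (m + 1))) :
    worstExpectedFocusedRisk αsys α p ∈ Set.Icc (0 : ℝ) 1 := by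
  rw [worstExpectedFocusedRisk,
    sSup_focused_eq fun N G S => ∑ j, p j * focusedRisk αsys G S (α j)]
  exact iSup_mem_Icc fun x => sum_mul_mem_Icc hp fun j => focusedRisk_mem_Icc hs _ _ _

theorem worstBroadRisk_mul_sum_le (hs : 0 < αsys) (hα : StrictMono α) (hα0 : αsys ≤ α 0)
    (hp : p ∈ stdSimplex ℝ (Fin (m + 1))) (k : Fin (m + 1)) :
    worstBroadRisk αsys (α k) * ∑ j ∈ Finset.univ.filter (· ≤ k), p j ≤
      worstExpectedBroadRisk αsys α p := by
  have hpos : ∀ j, 0 < α j := fun j => hs.trans_le (hα0.trans (hα.monotone (Fin.zero_le j)))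
  rw [worstBroadRisk, worstExpectedBroadRisk,
    sSup_broad_eq fun N G S => broadRisk αsys G S (α k),
    sSup_broad_eq fun N G S => ∑ j, p j * broadRisk αsys G S (α j)]
  refine iSup_mul_sum_le (R := fun (x : BroadInstance) j => broadRisk αsys x.1.G x.2 (α j))
    (fun x j => broadRisk_mem_Icc hs _ _ _) hp fun x => ?_
  obtain ⟨N', hN', G', hG', S', h⟩ :=
    exists_dominating_broad x.1.connected x.1.three_le hs (hpos k) x.2
  exact ⟨⟨⟨N', hN', G', hG'⟩, S'⟩, fun j hj =>
    h _ (hpos j) (hα.monotone (Finset.mem_filter.1 hj).2)⟩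

theorem worstFocusedRisk_mul_sum_le (hs : 0 < αsys) (hα : StrictMono α) (hα0 : αsys ≤ α 0)
    (hp : p ∈ stdSimplex ℝ (Fin (m + 1))) (k : Fin (m + 1)) :
    worstFocusedRisk αsys (α k) * ∑ j ∈ Finset.univ.filter (k ≤ ·), p j ≤
      worstExpectedFocusedRisk αsys α p := by
  rw [worstFocusedRisk, worstExpectedFocusedRisk,
    sSup_focused_eq fun N G S => focusedRisk αsys G S (α k),
    sSup_focused_eq fun N G S => ∑ j, p j * focusedRisk αsys G S (α j)]
  refine iSup_mul_sum_le (R := fun (x : FocusedInstance) j => focusedRisk αsys x.1.G x.2 (α j))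
    (fun x j => focusedRisk_mem_Icc hs _ _ _) hp fun x => ⟨x, fun j hj => ?_⟩
  exact focusedRisk_mono _ (by have := x.1.three_le; omega) hs
    (hα0.trans (hα.monotone (Fin.zero_le k))) (hα.monotone (Finset.mem_filter.1 hj).2) x.2

end Suprema

/-! ### The linear program -/

section LinearProgram

variable {αsys γ : ℝ} {m : ℕ} {α p : Fin (m + 1) → ℝ} {v : ℝ}

/-- Each row of the triangular matrices is constant on its support, so it yields a worst-case risk
times a tail or head mass of `p`. -/
theorem lpMatrix_mulVec_le_iff :
    (lpMatrix αsys α).mulVec (Sum.elim p fun _ => v) ≤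
      Sum.elim (fun _ => (0 : ℝ)) (fun _ => γ) ↔
    (∀ k, worstFocusedRisk αsys (α k) * ∑ j ∈ Finset.univ.filter (k ≤ ·), p j ≤ v) ∧
      ∀ k, worstBroadRisk αsys (α k) * ∑ j ∈ Finset.univ.filter (· ≤ k), p j ≤ γ := by
  rw [lpMatrix, Matrix.fromBlocks_mulVec, Sum.elim_le_elim_iff]
  refine and_congr (forall_congr' fun k => ?_) (forall_congr' fun k => ?_)
  · have : ((focusedMatrix αsys α).mulVec p) k =
        worstFocusedRisk αsys (α k) * ∑ j ∈ Finset.univ.filter (k ≤ ·), p j := by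
      simp [Matrix.mulVec, dotProduct, focusedMatrix, Finset.mul_sum, Finset.sum_filter]
    rw [← this]
    simp [Matrix.mulVec, dotProduct]
  · have : ((broadMatrix αsys α).mulVec p) k =
        worstBroadRisk αsys (α k) * ∑ j ∈ Finset.univ.filter (· ≤ k), p j := by
      simp [Matrix.mulVec, dotProduct, broadMatrix, Finset.mul_sum, Finset.sum_filter]
    simp [this]

theorem lpFeasible_iff : LPFeasible αsys γ α p v ↔
    p ∈ stdSimplex ℝ (Fin (m + 1)) ∧ v ∈ Set.Icc (0 : ℝ) 1 ∧
    (∀ k, worstFocusedRisk αsys (α k) * ∑ j ∈ Finset.univ.filter (k ≤ ·), p j ≤ v) ∧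
      ∀ k, worstBroadRisk αsys (α k) * ∑ j ∈ Finset.univ.filter (· ≤ k), p j ≤ γ :=
  ⟨fun h => ⟨⟨h.nonneg, h.sum_eq_one⟩, h.mem_Icc, lpMatrix_mulVec_le_iff.1 h.constraint⟩,
    fun h => ⟨h.1.2, h.1.1, h.2.1, lpMatrix_mulVec_le_iff.2 h.2.2⟩⟩

/-- The point mass at the largest gain, with `v = 1`, is feasible: only the last broad row sees any
mass, and there `γ` is assumed large enough. -/
theorem lpValues_nonempty (hs : 0 < αsys)
    (hγ : worstBroadRisk αsys (α (Fin.last m)) ≤ γ) : (lpValues αsys γ α).Nonempty := by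
  have hp : Pi.single (Fin.last m) 1 ∈ stdSimplex ℝ (Fin (m + 1)) := single_mem_stdSimplex ℝ _
  have hle : ∀ J : Finset (Fin (m + 1)),
      ∑ j ∈ J, (Pi.single (Fin.last m) 1 : Fin (m + 1) → ℝ) j ≤ 1 := fun J =>
    (Finset.sum_le_sum_of_subset_of_nonneg (Finset.subset_univ J) fun j _ _ => hp.1 j).trans
      hp.2.le
  refine ⟨1, Pi.single (Fin.last m) 1, lpFeasible_iff.2 ⟨hp, by simp, fun k => ?_, fun k => ?_⟩⟩
  · exact mul_le_one₀ (worstFocusedRisk_mem_Icc hs _).2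
      (Finset.sum_nonneg fun j _ => hp.1 j) (hle _)
  · rcases (Fin.le_last k).eq_or_lt with rfl | hk
    · exact (mul_le_of_le_one_right (worstBroadRisk_mem_Icc hs _).1 (hle _)).trans hγ
    · rw [Finset.sum_eq_zero, mul_zero]
      · exact (worstBroadRisk_mem_Icc hs _).1.trans hγ
      · intro j hj
        exact Pi.single_eq_of_ne (((Finset.mem_filter.1 hj).2.trans_lt hk).ne) _

theorem isCompact_lpValues : IsCompact (lpValues αsys γ α) := by
  have h : lpValues αsys γ α = Prod.snd '' ((stdSimplex ℝ (Fin (m + 1)) ×ˢ Set.Icc (0 : ℝ) 1) ∩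
      {q : (Fin (m + 1) → ℝ) × ℝ |
        (∀ k, worstFocusedRisk αsys (α k) * ∑ j ∈ Finset.univ.filter (k ≤ ·), q.1 j ≤ q.2) ∧
        ∀ k, worstBroadRisk αsys (α k) * ∑ j ∈ Finset.univ.filter (· ≤ k), q.1 j ≤ γ}) := by
    ext v
    constructor
    · rintro ⟨p, hp⟩
      obtain ⟨h1, h2, h3⟩ := lpFeasible_iff.1 hp
      exact ⟨(p, v), ⟨⟨h1, h2⟩, h3⟩, rfl⟩
    · rintro ⟨⟨p, v⟩, ⟨⟨h1, h2⟩, h3⟩, rfl⟩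
      exact ⟨p, lpFeasible_iff.2 ⟨h1, h2, h3⟩⟩
  rw [h]
  refine (((isCompact_stdSimplex ℝ _).prod isCompact_Icc).inter_right ?_).image continuous_snd
  rw [Set.ofPred_and, Set.ofPred_forall, Set.ofPred_forall]
  exact (isClosed_iInter fun k => isClosed_le (by fun_prop) (by fun_prop)).inter
    (isClosed_iInter fun k => isClosed_le (by fun_prop) (by fun_prop))

theorem isLeast_lpValue (hs : 0 < αsys) (hγ : worstBroadRisk αsys (α (Fin.last m)) ≤ γ) :
    IsLeast (lpValues αsys γ α) (lpValue αsys γ α) :=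
  isCompact_lpValues.isLeast_sInf (lpValues_nonempty hs hγ)

theorem lpValues_mono {γ' : ℝ} (h : γ ≤ γ') : lpValues αsys γ α ⊆ lpValues αsys γ' α := by
  rintro v ⟨p, hp⟩
  obtain ⟨h1, h2, h3, h4⟩ := lpFeasible_iff.1 hp
  exact ⟨p, lpFeasible_iff.2 ⟨h1, h2, h3, fun k => (h4 k).trans h⟩⟩

end LinearProgram

end CoordinationGame

theorem corollary4 (αsys : ℝ) (hsys : 0 < αsys) (m : ℕ) (α : Fin (m + 1) → ℝ)
    (hα : StrictMono α) (hα0 : αsys ≤ α 0) :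
    (∀ γ ∈ Set.Icc (worstBroadRisk αsys (α (Fin.last m))) 1,
      IsLeast (lpValues αsys γ α) (lpValue αsys γ α) ∧
      ∀ p ∈ stdSimplex ℝ (Fin (m + 1)), worstExpectedBroadRisk αsys α p ≤ γ →
        lpValue αsys γ α ≤ worstExpectedFocusedRisk αsys α p) ∧
    AntitoneOn (fun γ => lpValue αsys γ α)
      (Set.Icc (worstBroadRisk αsys (α (Fin.last m))) 1) := by
  refine ⟨fun γ hγ => ⟨isLeast_lpValue hsys hγ.1, fun p hp hle => ?_⟩, fun γ hγ γ' hγ' h => ?_⟩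
  -- The pair of `p` and its worst-case expected focused risk is feasible, so the minimum lies below
  -- that risk.
  · exact (isLeast_lpValue hsys hγ.1).2 ⟨p, lpFeasible_iff.2
      ⟨hp, worstExpectedFocusedRisk_mem_Icc hsys hp,
        fun k => worstFocusedRisk_mul_sum_le hsys hα hα0 hp k,
        fun k => (worstBroadRisk_mul_sum_le hsys hα hα0 hp k).trans hle⟩⟩
  · exact (isLeast_lpValue hsys hγ'.1).2 (lpValues_mono h (isLeast_lpValue hsys hγ.1).1)
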